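/- Let $\mathcal X,\mathcal Y$ be finite alphabets, let $\{p(y|x)\}$ be the transition probabilities of a discrete memoryless channel, so that $p(\mathbf y|\mathbf x)=\prod_{i=1}^n p(y_i|x_i)$ for $\mathbf x\in\mathcal X^n$, $\mathbf y\in\mathcal Y^n$, and let $Q=\{q(x)\}$ be a probability distribution on $\mathcal X$. For $\rho\ge 1$ and $0\le s\le 1$ put $$E(\rho,s,Q)=-\rho\sum_{x\in\mathcal X}q(x)\ln\Big(\sum_{x'\in\mathcal X}q(x')\Big[\sum_{y\in\mathcal Y}p^{1-s}(y|x)\,p^{s}(y|x')\Big]^{1/\rho}\Big)$$ (terms with $q(x)=0$ are $0$, and $0^0=1$), and for real $R$ $$\mathcal E(R,Q)=\sup_{\rho\ge1}\ \sup_{0\le s\le1}\,[E(\rho,s,Q)-\rho R]\in(-\infty,+\infty].$$ **Theorem 1.** Let $R\ge 0$ and let $(M_n)$ be any sequence of positive integers of rate $R$, i.e. $\frac1n\ln M_n\to R$ (for instance $M_n=\lceil e^{nR}\rceil$). Then there is a sequence of codes $\mathcal C_n=(\mathbf x_1,\dots,\mathbf x_{M_n})$, $\mathbf x_m\in\mathcal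 X^n$ (codewords indexed by the messages, not required to be distinct), of composition $Q$ — that is, for each $n$ all codewords of $\mathcal C_n$ have the same empirical distribution $Q_n$, and $Q_n\to Q$ as $n\to\infty$ — such that, for maximum likelihood decoding with any rule for breaking ties, the maximum error probability $P_{e,\max}(\mathcal C_n)=\max_{1\le m\le M_n}\Pr\{\text{error}\mid m\text{ sent}\}$ satisfies $$\liminf_{n\to\infty}\Big[-\frac1n\ln P_{e,\max}(\mathcal C_n)\Big]\ \ge\ \mathcal E(R,Q),$$ where $-\ln 0=+\infty$. -/

import Mathlib

open Filter Topology

namespace ChannelCoding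

noncomputable section

/-- A discrete memoryless channel with finite input alphabet `X` and finite output alphabet `Y`,
given by its single-letter transition probabilities `p x y = p(y|x)`. -/
structure DMC (X Y : Type*) [Fintype Y] where
  p : X → Y → ℝ
  nonneg : ∀ x y, 0 ≤ p x y
  sum_eq_one : ∀ x, ∑ y, p x y = 1

/-- The block transition probability `p(𝐲|𝐱) = ∏ᵢ p(yᵢ|xᵢ)`. -/
def DMC.blockProb {X Y : Type*} [Fintype Y] (W : DMC X Y) {n : ℕ}
    (x : Fin n → X) (y : Fin n → Y) : ℝ :=
  ∏ i, W.p (x i) (y i)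

/-- A code of block length `n` with `M` codewords: message `m` is sent as the word `C m`. -/
abbrev Code (X : Type*) (n M : ℕ) := Fin M → (Fin n → X)

/-- The empirical distribution of a word: the relative frequency of each letter. -/
def empiricalDist {X : Type*} [DecidableEq X] {n : ℕ} (x : Fin n → X) : X → ℝ :=
  fun a => ((Finset.univ.filter fun i => x i = a).card : ℝ) / (n : ℝ)

/-- `g` is a maximum likelihood decoder for the code `C` (ties are broken arbitrarily). -/
def IsMLDecoder {X Y : Type*} [Fintype Y] (W : DMC X Y) {n M : ℕ} (C : Code X n M)
    (g : (Fin n → Y) → Fin M) : Prop :=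
  ∀ (y : Fin n → Y) (m : Fin M), W.blockProb (C m) y ≤ W.blockProb (C (g y)) y

/-- The error probability given that message `m` is sent, `Pr{error | m sent}`. -/
def condErrorProb {X Y : Type*} [Fintype Y] (W : DMC X Y) {n M : ℕ} (C : Code X n M)
    (g : (Fin n → Y) → Fin M) (m : Fin M) : ℝ :=
  ∑ y ∈ Finset.univ.filter (fun y : Fin n → Y => g y ≠ m), W.blockProb (C m) y

/-- The maximum error probability over all messages. -/
def maxErrorProb {X Y : Type*} [Fintype Y] (W : DMC X Y) {n M : ℕ} (C : Code X n M)
    (g : (Fin n → Y) → Fin M) : ℝ :=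
  ⨆ m, condErrorProb W C g m

/-- The exponent `liminf_n -(1/n) ln P n` of a sequence of probabilities, with `-ln 0 = +∞`. -/
def errorExponent (P : ℕ → ℝ) : EReal :=
  liminf (fun n : ℕ => -ENNReal.log (ENNReal.ofReal (P n)) / (n : EReal)) atTop

/-- `E(ρ,s,Q) = -ρ ∑ₓ q(x) ln (∑ₓ' q(x') [∑_y p(y|x)^(1-s) p(y|x')^s]^(1/ρ))`.
If `q(x) > 0` the argument of the logarithm is at least `q(x)`; if `q(x) = 0` the term is `0`. -/
def expurgatedE {X Y : Type*} [Fintype X] [Fintype Y] (W : DMC X Y) (q : X → ℝ)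
    (ρ s : ℝ) : ℝ :=
  -ρ * ∑ x, q x *
    Real.log (∑ x', q x' * (∑ y, W.p x y ^ (1 - s) * W.p x' y ^ s) ^ (1 / ρ))

/-- `𝓔(R,Q) = sup_{ρ ≥ 1} sup_{0 ≤ s ≤ 1} [E(ρ,s,Q) - ρ R]`, a possibly infinite supremum. -/
def expurgatedExponent {X Y : Type*} [Fintype X] [Fintype Y] (W : DMC X Y) (R : ℝ)
    (q : X → ℝ) : EReal :=
  ⨆ (ρ : ℝ) (_ : 1 ≤ ρ) (s : ℝ) (_ : s ∈ Set.Icc (0 : ℝ) 1),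
    ((expurgatedE W q ρ s - ρ * R : ℝ) : EReal)

end

end ChannelCoding

/-! Random coding with expurgation, over one type class per block length. Chebyshev's inequality and
a pigeonhole over the polynomially many types give a type near `q` whose class has `q`-probability
at least an inverse polynomial (`exists_likely_letterCount`). Uniform draws from this class
therefore cost only a polynomial factor over independent letters (`sum_letterCount_prod_le`), while
every codeword has the same letter counts; this puts the sum over `x` outside the logarithm in `E`.

The error is handled through its power `1/ρ`: a union bound over pairs of codewords, subadditivity
of `z ↦ z ^ (1/ρ)`, and removal of the worse half of a random code of size `2M` bound it for every
message; raising to the power `ρ` gives the exponent.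

The supremum over `(ρ, s)` need not be attained or finite, so one code must serve all parameters. A
code on the type class that minimizes the worst error does: it is no worse than the code built for
any given `(ρ, s)`. Counting ties as errors makes this choice independent of the decoder. -/

namespace ChannelCoding

/-! ### Letter counts and type classes. -/

section LetterCount

variable {X : Type*} [DecidableEq X]

/-- The number of occurrences of each letter in a word. -/
def letterCount {n : ℕ} (x : Fin n → X) (a : X) : ℕ :=
  (Finset.univ.filter fun i => x i = a).card

theorem letterCount_le {n : ℕ} (x : Fin n → X) (a : X) : letterCount x a ≤ n := by
  simpa [letterCount] using
    Finset.card_filter_le (Finset.univ : Finset (Fin n)) (fun i => x i = a)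

theorem empiricalDist_eq {n : ℕ} (x : Fin n → X) :
    empiricalDist x = fun a => (letterCount x a : ℝ) / n := rfl

end LetterCount

section Types

variable {X : Type*} [Fintype X]

theorem sum_prod_eq_one {q : X → ℝ} (hq : ∑ a, q a = 1) (n : ℕ) :
    ∑ x : Fin n → X, ∏ i, q (x i) = 1 := by
  classical
  have h := Finset.prod_univ_sum (fun _ : Fin n => (Finset.univ : Finset X)) (fun _ a => q a)
  simp only [hq, Finset.prod_const_one, Fintype.piFinset_univ] at h
  exact h.symm

theorem sum_fin_succ_fun (n : ℕ) (F : (Fin (n + 1) → X) → ℝ) :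
    ∑ x, F x = ∑ a, ∑ x : Fin n → X, F (Fin.cons a x) := by
  rw [← Fintype.sum_prod_type' (f := fun (a : X) (x : Fin n → X) => F (Fin.cons a x))]
  exact (Fintype.sum_equiv (Fin.consEquiv (fun _ => X)) _ _ (fun _ => rfl)).symm

theorem sum_prod_mul_sum_eq_zero {q g : X → ℝ} (hq : ∑ a, q a = 1) (hg : ∑ a, q a * g a = 0)
    (n : ℕ) : ∑ x : Fin n → X, (∏ i, q (x i)) * ∑ i, g (x i) = 0 := by
  induction n with
  | zero => simp
  | succ n ih =>
    rw [sum_fin_succ_fun]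
    have h : ∀ a : X, ∑ x : Fin n → X, (∏ i, q ((Fin.cons a x : Fin (n + 1) → X) i)) *
        ∑ i, g ((Fin.cons a x : Fin (n + 1) → X) i) = q a * g a := by
      intro a
      have : ∀ x : Fin n → X, (∏ i, q ((Fin.cons a x : Fin (n + 1) → X) i)) *
        ∑ i, g ((Fin.cons a x : Fin (n + 1) → X) i) = q a * g a * (∏ i, q (x i)) +
          q a * ((∏ i, q (x i)) * ∑ i, g (x i)) := by
        intro x
        rw [Fin.prod_univ_succ, Fin.sum_univ_succ]
        simp only [Fin.cons_zero, Fin.cons_succ]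
        ring
      simp only [this]
      rw [Finset.sum_add_distrib, ← Finset.mul_sum, ← Finset.mul_sum, ih, sum_prod_eq_one hq]
      ring
    simp only [h, hg]

/-- Variance of a sum of independent centred letters: the cross terms vanish by
`sum_prod_mul_sum_eq_zero`. -/
theorem sum_prod_mul_sum_sq {q g : X → ℝ} (hq : ∑ a, q a = 1) (hg : ∑ a, q a * g a = 0)
    (n : ℕ) : ∑ x : Fin n → X, (∏ i, q (x i)) * (∑ i, g (x i)) ^ 2 =
      n * ∑ a, q a * g a ^ 2 := by
  induction n with
  | zero => simp
  | succ n ih =>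
    rw [sum_fin_succ_fun]
    have h : ∀ a : X, ∑ x : Fin n → X, (∏ i, q ((Fin.cons a x : Fin (n + 1) → X) i)) *
        (∑ i, g ((Fin.cons a x : Fin (n + 1) → X) i)) ^ 2 =
          q a * g a ^ 2 + q a * (n * ∑ a, q a * g a ^ 2) := by
      intro a
      have : ∀ x : Fin n → X, (∏ i, q ((Fin.cons a x : Fin (n + 1) → X) i)) *
        (∑ i, g ((Fin.cons a x : Fin (n + 1) → X) i)) ^ 2 = q a * g a ^ 2 * (∏ i, q (x i)) +
          (2 * q a * g a * ((∏ i, q (x i)) * ∑ i, g (x i)) +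
          q a * ((∏ i, q (x i)) * (∑ i, g (x i)) ^ 2)) := by
        intro x
        rw [Fin.prod_univ_succ, Fin.sum_univ_succ]
        simp only [Fin.cons_zero, Fin.cons_succ]
        ring
      simp only [this]
      rw [Finset.sum_add_distrib, Finset.sum_add_distrib, ← Finset.mul_sum, ← Finset.mul_sum,
        ← Finset.mul_sum, ih, sum_prod_eq_one hq, sum_prod_mul_sum_eq_zero hq hg]
      ring
    simp only [h]
    rw [Finset.sum_add_distrib, ← Finset.sum_mul, hq]
    push_cast
    ring

variable [DecidableEq X]

theorem prod_comp_eq_prod_letterCount {n : ℕ} (x : Fin n → X) (f : X → ℝ) :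
    ∏ i, f (x i) = ∏ a, f a ^ letterCount x a := by
  rw [← Finset.prod_fiberwise Finset.univ x]
  refine Finset.prod_congr rfl fun a _ => ?_
  rw [Finset.prod_congr rfl (g := fun _ => f a) (fun i hi => by rw [(Finset.mem_filter.1 hi).2])]
  simp [letterCount]

/-- The total squared deviation of the letter counts of a word from those expected under `q`. -/
def sqDeviation (q : X → ℝ) {n : ℕ} (x : Fin n → X) : ℝ :=
  ∑ a, ((letterCount x a : ℝ) - n * q a) ^ 2

theorem sum_prod_mul_sqDeviation_le {q : X → ℝ} (hq : q ∈ stdSimplex ℝ X) (n : ℕ) :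
    ∑ x : Fin n → X, (∏ i, q (x i)) * sqDeviation q x ≤ n := by
  simp only [sqDeviation, Finset.mul_sum]
  rw [Finset.sum_comm]
  have h : ∀ a : X, ∑ x : Fin n → X, (∏ i, q (x i)) * ((letterCount x a : ℝ) - n * q a) ^ 2 ≤
      n * q a := by
    intro a
    have hg : ∑ b, q b * ((if b = a then 1 else 0) - q a) = 0 := by
      simp [mul_sub, Finset.sum_sub_distrib, ← Finset.sum_mul, hq.2]
    have hg2 : ∑ b, q b * ((if b = a then 1 else 0) - q a) ^ 2 = q a - q a ^ 2 := by
      have : ∀ b, q b * ((if b = a then 1 else 0) - q a) ^ 2 =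
          (if b = a then q b * (1 - 2 * q a) else 0) + q b * q a ^ 2 := by
        intro b; split_ifs <;> ring
      simp only [this, Finset.sum_add_distrib, ← Finset.sum_mul, hq.2]
      simp
      ring
    have key := sum_prod_mul_sum_sq hq.2 hg n
    have e : ∀ x : Fin n → X, ∑ i, ((if x i = a then (1 : ℝ) else 0) - q a) =
        (letterCount x a : ℝ) - n * q a := by
      intro x; simp [letterCount, Finset.sum_sub_distrib]
    simp only [e] at key
    rw [key, hg2]
    have := sq_nonneg (q a)
    have hn : (0 : ℝ) ≤ n := Nat.cast_nonneg n
    nlinarith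
  calc _ ≤ ∑ a, (n : ℝ) * q a := Finset.sum_le_sum fun a _ => h a
    _ = n := by rw [← Finset.mul_sum, hq.2, mul_one]

theorem half_le_sum_prod_typical {q : X → ℝ} (hq : q ∈ stdSimplex ℝ X) (n : ℕ) :
    1 / 2 ≤ ∑ x : Fin n → X with sqDeviation q x ≤ 2 * n + 1, ∏ i, q (x i) := by
  have hP : ∀ x : Fin n → X, 0 ≤ ∏ i, q (x i) := fun x => Finset.prod_nonneg fun i _ => hq.1 _
  have h1 := Finset.sum_filter_add_sum_filter_not (Finset.univ : Finset (Fin n → X))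
    (fun x => sqDeviation q x ≤ 2 * n + 1) (fun x => ∏ i, q (x i))
  rw [sum_prod_eq_one hq.2] at h1
  -- Markov's inequality. The `+ 1` in the threshold keeps it positive at `n = 0`.
  have h2 : (2 * n + 1 : ℝ) * ∑ x : Fin n → X with ¬ sqDeviation q x ≤ 2 * n + 1, ∏ i, q (x i)
      ≤ n := by
    refine le_trans ?_ (sum_prod_mul_sqDeviation_le hq n)
    rw [Finset.mul_sum]
    refine le_trans (Finset.sum_le_sum (g := fun x => (∏ i, q (x i)) * sqDeviation q x)
      fun x hx => ?_) (Finset.sum_le_sum_of_subset_of_nonneg (Finset.subset_univ _) fun x _ _ =>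
        mul_nonneg (hP x) (Finset.sum_nonneg fun a _ => sq_nonneg _))
    rw [mul_comm]
    exact mul_le_mul_of_nonneg_left (not_le.1 (Finset.mem_filter.1 hx).2).le (hP x)
  have hn : (0 : ℝ) ≤ n := Nat.cast_nonneg n
  nlinarith

/-- A type class that is close to `q` and has polynomially bounded `q`-probability. -/
theorem exists_likely_letterCount {q : X → ℝ} (hq : q ∈ stdSimplex ℝ X) (n : ℕ) :
    ∃ k : X → ℕ, ∑ a, ((k a : ℝ) - n * q a) ^ 2 ≤ 2 * n + 1 ∧
      1 / (2 * (n + 1 : ℝ) ^ Fintype.card X) ≤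
        ∑ x : Fin n → X with letterCount x = k, ∏ i, q (x i) := by
  have hP : ∀ x : Fin n → X, 0 ≤ ∏ i, q (x i) := fun x => Finset.prod_nonneg fun i _ => hq.1 _
  set S : Finset (Fin n → X) := Finset.univ.filter fun x => sqDeviation q x ≤ 2 * n + 1 with hS
  set B : Finset (X → ℕ) := Fintype.piFinset fun _ => Finset.range (n + 1) with hB
  have hcard : (B.card : ℝ) = (n + 1 : ℝ) ^ Fintype.card X := by simp [hB]
  have hpos : (0 : ℝ) < (n + 1 : ℝ) ^ Fintype.card X := by positivity
  have hmaps : ∀ x ∈ S, letterCount x ∈ B := fun x _ => by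
    simp only [hB, Fintype.mem_piFinset, Finset.mem_range]
    exact fun a => Nat.lt_succ_of_le (letterCount_le x a)
  have hBne : B.Nonempty := by
    rw [← Finset.card_pos]
    exact_mod_cast hcard ▸ hpos
  -- Pigeonhole: the typical words carry mass at least 1/2 and fall into at most `(n + 1) ^ |X|`
  -- classes.
  have hsum : B.card • (1 / (2 * (n + 1 : ℝ) ^ Fintype.card X)) ≤ ∑ x ∈ S, ∏ i, q (x i) := by
    rw [nsmul_eq_mul, hcard]
    refine le_trans (le_of_eq ?_) (half_le_sum_prod_typical hq n)
    field_simp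
  obtain ⟨k, -, hk⟩ := Finset.exists_le_sum_fiber_of_maps_to_of_nsmul_le_sum hmaps hBne hsum
  have hkpos : 0 < ∑ x ∈ S with letterCount x = k, ∏ i, q (x i) :=
    lt_of_lt_of_le (by positivity) hk
  obtain ⟨x, hx⟩ := Finset.nonempty_of_sum_ne_zero hkpos.ne'
  simp only [hS, Finset.mem_filter, Finset.mem_univ, true_and] at hx
  refine ⟨k, ?_, hk.trans (Finset.sum_le_sum_of_subset_of_nonneg
    (Finset.filter_subset_filter _ (Finset.subset_univ _)) fun x _ _ => hP x)⟩
  rw [← hx.2]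
  exact hx.1

/-- Summing over a type class is, up to the reciprocal probability `κ⁻¹` of the class, averaging
over independent letters. -/
theorem sum_letterCount_prod_le {q : X → ℝ} (hq : q ∈ stdSimplex ℝ X) {n : ℕ} {k : X → ℕ} {κ : ℝ}
    (hκ : 0 < κ) (hk : κ ≤ ∑ x : Fin n → X with letterCount x = k, ∏ i, q (x i))
    {b : X → X → ℝ} (hb : ∀ a a', 0 ≤ b a a') (x : Fin n → X) :
    ∑ x' : Fin n → X with letterCount x' = k, ∏ i, b (x i) (x' i) ≤
      κ⁻¹ * (∏ i, ∑ a', q a' * b (x i) a') *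
        ((Finset.univ.filter fun x' : Fin n → X => letterCount x' = k).card : ℝ) := by
  set T := Finset.univ.filter fun x' : Fin n → X => letterCount x' = k with hT
  set c : ℝ := ∏ a, q a ^ k a with hc
  -- All words of a type class are equally likely under `q`, so uniform weights on the class are the
  -- product weights rescaled.
  have hPc : ∀ x' ∈ T, ∏ i, q (x' i) = c := fun x' hx' => by
    rw [prod_comp_eq_prod_letterCount, (Finset.mem_filter.1 hx').2]
  rw [Finset.sum_congr rfl hPc, Finset.sum_const, nsmul_eq_mul] at hk
  have hc0 : 0 ≤ c := Finset.prod_nonneg fun a _ => pow_nonneg (hq.1 a) _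
  have hcpos : 0 < c := by
    rcases hc0.eq_or_lt with h | h
    · rw [← h, mul_zero] at hk; exact absurd hk (not_le.2 hκ)
    · exact h
  have h1 : c * ∑ x' ∈ T, ∏ i, b (x i) (x' i) ≤ ∏ i, ∑ a', q a' * b (x i) a' := by
    rw [Finset.prod_univ_sum, Fintype.piFinset_univ, Finset.mul_sum]
    refine le_trans (Finset.sum_le_sum (g := fun x' => ∏ i, q (x' i) * b (x i) (x' i))
      fun x' hx' => ?_) (Finset.sum_le_sum_of_subset_of_nonneg (Finset.subset_univ _) fun x' _ _ =>
        Finset.prod_nonneg fun i _ => mul_nonneg (hq.1 _) (hb _ _))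
    rw [Finset.prod_mul_distrib, hPc x' hx']
  have hD : 0 ≤ ∏ i, ∑ a', q a' * b (x i) a' := Finset.prod_nonneg fun i _ =>
    Finset.sum_nonneg fun a' _ => mul_nonneg (hq.1 _) (hb _ _)
  set D := ∏ i, ∑ a', q a' * b (x i) a'
  have h2 : ∑ x' ∈ T, ∏ i, b (x i) (x' i) ≤ D / c := by
    rw [le_div_iff₀ hcpos, mul_comm]; exact h1
  refine h2.trans ?_
  rw [div_le_iff₀ hcpos]
  have : D * 1 ≤ D * (κ⁻¹ * (T.card * c)) := by
    refine mul_le_mul_of_nonneg_left ?_ hD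
    rw [inv_mul_eq_div, one_le_div hκ]; exact hk
  linarith [this]

end Types

/-! ### Random codes and expurgation. -/

section Expurgation

theorem exists_code_sum_le {α ι : Type*} [Fintype α] [Nonempty α] [Fintype ι] [DecidableEq ι]
    {f : α → α → ℝ} {A : ℝ} (hA : 0 ≤ A)
    (h : ∀ x, ∑ x', f x x' ≤ A * Fintype.card α) :
    ∃ C : ι → α, ∑ m, ∑ m' with m' ≠ m, f (C m) (C m') ≤ (Fintype.card ι : ℝ) ^ 2 * A := by
  -- Fix all codewords except the one at `m'`; averaging over that one is exactly `h`.
  have hpair : ∀ m m' : ι, m' ≠ m →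
      ∑ C : ι → α, f (C m) (C m') ≤ A * Fintype.card (ι → α) := by
    intro m m' hne
    have e := (Fintype.sum_equiv (Equiv.funSplitAt m' α).symm
      (fun p : α × ({j // j ≠ m'} → α) => f (p.2 ⟨m, hne.symm⟩) p.1)
      (fun C => f (C m) (C m')) (fun p => by
        simp [Equiv.funSplitAt, Equiv.piSplitAt, hne.symm]))
    rw [← e, Fintype.sum_prod_type_right, Fintype.card_congr (Equiv.funSplitAt m' α),
      Fintype.card_prod]
    refine (Finset.sum_le_sum fun r _ => h (r ⟨m, hne.symm⟩)).trans (le_of_eq ?_)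
    rw [Finset.sum_const, Finset.card_univ, nsmul_eq_mul]
    push_cast
    ring
  have htot : ∑ C : ι → α, ∑ m, ∑ m' with m' ≠ m, f (C m) (C m') ≤
      ∑ _C : ι → α, (Fintype.card ι : ℝ) ^ 2 * A := by
    rw [Finset.sum_comm]
    have : ∀ m : ι, ∑ C : ι → α, ∑ m' with m' ≠ m, f (C m) (C m') ≤
        Fintype.card ι * (A * Fintype.card (ι → α)) := by
      intro m
      rw [Finset.sum_comm]
      refine (Finset.sum_le_card_nsmul _ _ _ fun m' hm' =>
        hpair m m' (Finset.mem_filter.1 hm').2).trans ?_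
      rw [nsmul_eq_mul]
      refine mul_le_mul_of_nonneg_right ?_ (by positivity)
      exact_mod_cast Finset.card_le_univ _
    refine (Finset.sum_le_sum fun m _ => this m).trans (le_of_eq ?_)
    simp only [Finset.sum_const, Finset.card_univ, nsmul_eq_mul]
    ring
  obtain ⟨C, -, hC⟩ := Finset.exists_le_of_sum_le Finset.univ_nonempty htot
  exact ⟨C, hC⟩

/-- Among `2M` random words the mean row sum is at most `2MA`, so at most `M` rows exceed twice
that. Discarding them leaves at least `M` words, and since `f ≥ 0` the remaining row sums only
decrease. -/
theorem exists_expurgated_code {α : Type*} [Fintype α] [Nonempty α] {f : α → α → ℝ}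
    (hf : ∀ x x', 0 ≤ f x x') {A : ℝ} (hA : 0 ≤ A)
    (h : ∀ x, ∑ x', f x x' ≤ A * Fintype.card α) (M : ℕ) :
    ∃ C : Fin M → α, ∀ m, ∑ m' with m' ≠ m, f (C m) (C m') ≤ 4 * M * A := by
  obtain ⟨C, hC⟩ := exists_code_sum_le (ι := Fin (2 * M)) hA h
  rw [Fintype.card_fin] at hC
  push_cast at hC
  set F : Fin (2 * M) → ℝ := fun m => ∑ m' with m' ≠ m, f (C m) (C m') with hF
  have hF0 : ∀ m, 0 ≤ F m := fun m => Finset.sum_nonneg fun _ _ => hf _ _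
  set good := Finset.univ.filter fun m => F m ≤ 4 * M * A with hgood
  set bad := Finset.univ.filter fun m => ¬ F m ≤ 4 * M * A with hbad
  have hcard : good.card + bad.card = 2 * M := by
    rw [Finset.card_filter_add_card_filter_not, Finset.card_univ, Fintype.card_fin]
  have hbadM : bad.card ≤ M := by
    by_contra! hlt
    have hne : bad.Nonempty := Finset.card_pos.1 (by omega)
    have h1 : ∑ _m ∈ bad, (4 * M * A) < ∑ m ∈ bad, F m :=
      Finset.sum_lt_sum_of_nonempty hne fun m hm => not_le.1 (Finset.mem_filter.1 hm).2
    have h2 : ∑ m ∈ bad, F m ≤ ∑ m, F m :=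
      Finset.sum_le_sum_of_subset_of_nonneg (Finset.subset_univ _) fun m _ _ => hF0 m
    rw [Finset.sum_const, nsmul_eq_mul] at h1
    have h3 : (M : ℝ) * (4 * M * A) ≤ bad.card * (4 * M * A) :=
      mul_le_mul_of_nonneg_right (by exact_mod_cast hlt.le) (by positivity)
    have h4 : ∑ m, F m ≤ (2 * M) ^ 2 * A := hC
    nlinarith
  have hgoodM : M ≤ good.card := by omega
  set e : Fin M ↪ Fin (2 * M) :=
    (Fin.castLEEmb hgoodM).trans (good.orderEmbOfFin rfl).toEmbedding with he
  refine ⟨fun m => C (e m), fun m => ?_⟩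
  have hem : e m ∈ good := good.orderEmbOfFin_mem rfl _
  refine le_trans ?_ (Finset.mem_filter.1 hem).2
  rw [← Finset.sum_map (Finset.univ.filter fun m' => m' ≠ m) e (fun j => f (C (e m)) (C j))]
  refine Finset.sum_le_sum_of_subset_of_nonneg (fun j hj => ?_) fun _ _ _ => hf _ _
  obtain ⟨m', hm', rfl⟩ := Finset.mem_map.1 hj
  simpa using (Finset.mem_filter.1 hm').2

end Expurgation

/-! ### Error bounds for maximum likelihood decoding. -/

section Decoding

variable {X Y : Type*} [Fintype Y] {W : DMC X Y}

theorem DMC.blockProb_nonneg (W : DMC X Y) {n : ℕ} (x : Fin n → X) (y : Fin n → Y) :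
    0 ≤ W.blockProb x y :=
  Finset.prod_nonneg fun _ _ => W.nonneg _ _

/-- The tilted affinity `∑_y p(y|x)^(1-s) p(y|x')^s` of two input letters. -/
noncomputable def DMC.affinity (W : DMC X Y) (s : ℝ) (x x' : X) : ℝ :=
  ∑ y, W.p x y ^ (1 - s) * W.p x' y ^ s

theorem DMC.affinity_nonneg (W : DMC X Y) (s : ℝ) (x x' : X) : 0 ≤ W.affinity s x x' :=
  Finset.sum_nonneg fun _ _ =>
    mul_nonneg (Real.rpow_nonneg (W.nonneg _ _) _) (Real.rpow_nonneg (W.nonneg _ _) _)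

theorem rpow_one_sub_mul_rpow_self {a s : ℝ} (ha : 0 ≤ a) (hs : s ∈ Set.Icc (0 : ℝ) 1) :
    a ^ (1 - s) * a ^ s = a := by
  rw [← Real.rpow_add_of_nonneg ha (by linarith [hs.2]) hs.1, sub_add_cancel, Real.rpow_one]

theorem DMC.affinity_self (W : DMC X Y) {s : ℝ} (hs : s ∈ Set.Icc (0 : ℝ) 1) (x : X) :
    W.affinity s x x = 1 := by
  simp only [DMC.affinity, rpow_one_sub_mul_rpow_self (W.nonneg _ _) hs, W.sum_eq_one]

theorem DMC.sum_blockProb_rpow (W : DMC X Y) (s : ℝ) {n : ℕ} (x x' : Fin n → X) :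
    ∑ y, W.blockProb x y ^ (1 - s) * W.blockProb x' y ^ s = ∏ i, W.affinity s (x i) (x' i) := by
  classical
  simp only [DMC.affinity]
  rw [Finset.prod_univ_sum, Fintype.piFinset_univ]
  refine Finset.sum_congr rfl fun y _ => ?_
  rw [Finset.prod_mul_distrib, DMC.blockProb, DMC.blockProb,
    Real.finsetProd_rpow _ _ (fun i _ => W.nonneg _ _),
    Real.finsetProd_rpow _ _ (fun i _ => W.nonneg _ _)]

open Classical in
/-- The probability, when `m` is sent, that some other message is at least as likely: the error
probability of maximum likelihood decoding when ties are counted as errors. -/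
noncomputable def pessimisticError (W : DMC X Y) {n M : ℕ} (C : Code X n M) (m : Fin M) : ℝ :=
  ∑ y with ∃ m' ≠ m, W.blockProb (C m) y ≤ W.blockProb (C m') y, W.blockProb (C m) y

theorem condErrorProb_le_pessimisticError {n M : ℕ} {C : Code X n M} {g : (Fin n → Y) → Fin M}
    (hg : IsMLDecoder W C g) (m : Fin M) : condErrorProb W C g m ≤ pessimisticError W C m := by
  classical
  refine Finset.sum_le_sum_of_subset_of_nonneg (fun y hy => ?_)
    fun y _ _ => W.blockProb_nonneg _ _
  simp only [Finset.mem_filter, Finset.mem_univ, true_and] at hy ⊢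
  exact ⟨g y, hy, hg y m⟩

theorem pessimisticError_nonneg {n M : ℕ} (C : Code X n M) (m : Fin M) :
    0 ≤ pessimisticError W C m :=
  Finset.sum_nonneg fun _ _ => W.blockProb_nonneg _ _

/-- Union bound with tilting: where `p ≤ p'`, one has `p = p ^ (1 - s) * p ^ s ≤ p ^ (1 - s) * p' ^
s`. -/
theorem pessimisticError_le {s : ℝ} (hs : s ∈ Set.Icc (0 : ℝ) 1) {n M : ℕ} (C : Code X n M)
    (m : Fin M) :
    pessimisticError W C m ≤ ∑ m' with m' ≠ m, ∏ i, W.affinity s (C m i) (C m' i) := by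
  classical
  simp only [← W.sum_blockProb_rpow]
  rw [Finset.sum_comm, pessimisticError]
  have h0 : ∀ m' y, 0 ≤ W.blockProb (C m) y ^ (1 - s) * W.blockProb (C m') y ^ s := fun m' y =>
    mul_nonneg (Real.rpow_nonneg (W.blockProb_nonneg _ _) _)
      (Real.rpow_nonneg (W.blockProb_nonneg _ _) _)
  refine le_trans (Finset.sum_le_sum fun y hy => ?_) (Finset.sum_le_sum_of_subset_of_nonneg
    (Finset.subset_univ _) fun y _ _ => Finset.sum_nonneg fun m' _ => h0 m' y)
  obtain ⟨m', hne, hle⟩ := (Finset.mem_filter.1 hy).2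
  refine le_trans ?_ (Finset.single_le_sum (fun m' _ => h0 m' y)
    (Finset.mem_filter.2 ⟨Finset.mem_univ m', hne⟩))
  conv_lhs => rw [← rpow_one_sub_mul_rpow_self (W.blockProb_nonneg (C m) y) hs]
  exact mul_le_mul_of_nonneg_left (Real.rpow_le_rpow (W.blockProb_nonneg _ _) hle hs.1)
    (Real.rpow_nonneg (W.blockProb_nonneg _ _) _)

theorem rpow_sum_le_sum_rpow {ι : Type*} (S : Finset ι) {z : ι → ℝ} (hz : ∀ i, 0 ≤ z i) {r : ℝ}
    (hr : 0 < r) (hr1 : r ≤ 1) : (∑ i ∈ S, z i) ^ r ≤ ∑ i ∈ S, z i ^ r := by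
  classical
  induction S using Finset.induction_on with
  | empty => simp [Real.zero_rpow hr.ne']
  | insert a S ha ih =>
    rw [Finset.sum_insert ha, Finset.sum_insert ha]
    exact (Real.rpow_add_le_add_rpow (hz a) (Finset.sum_nonneg fun i _ => hz i) hr.le hr1).trans
      (by gcongr)

theorem pessimisticError_rpow_le {s ρ : ℝ} (hs : s ∈ Set.Icc (0 : ℝ) 1) (hρ : 1 ≤ ρ) {n M : ℕ}
    (C : Code X n M) (m : Fin M) :
    pessimisticError W C m ^ (1 / ρ) ≤
      ∑ m' with m' ≠ m, ∏ i, W.affinity s (C m i) (C m' i) ^ (1 / ρ) := by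
  have hρ0 : 0 < ρ := by linarith
  refine (Real.rpow_le_rpow (pessimisticError_nonneg C m) (pessimisticError_le hs C m)
    (by positivity)).trans ?_
  refine (rpow_sum_le_sum_rpow _ (fun m' => Finset.prod_nonneg fun i _ => W.affinity_nonneg _ _ _)
    (by positivity) ((div_le_one hρ0).2 hρ)).trans (le_of_eq ?_)
  refine Finset.sum_congr rfl fun m' _ => ?_
  rw [Real.finsetProd_rpow _ _ (fun i _ => W.affinity_nonneg _ _ _)]

end Decoding

/-! ### Exponents and the choice of code. -/

section Exponent

variable {X Y : Type*} [Fintype X] [Fintype Y] {W : DMC X Y}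

/-- The number `∑ₓ' q(x') [∑_y p(y|x)^(1-s) p(y|x')^s]^(1/ρ)`. -/
noncomputable def DMC.meanAffinity (W : DMC X Y) (q : X → ℝ) (ρ s : ℝ) (x : X) : ℝ :=
  ∑ x', q x' * W.affinity s x x' ^ (1 / ρ)

/-- The term `x' = x` alone contributes `q x`, because a letter has affinity 1 with itself. -/
theorem DMC.meanAffinity_pos {q : X → ℝ} (hq : q ∈ stdSimplex ℝ X) (ρ : ℝ) {s : ℝ}
    (hs : s ∈ Set.Icc (0 : ℝ) 1) {x : X} (hx : q x ≠ 0) : 0 < W.meanAffinity q ρ s x := by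
  refine lt_of_lt_of_le ((hq.1 x).lt_of_ne' hx) ?_
  refine le_trans (le_of_eq ?_) (Finset.single_le_sum (fun x' _ =>
    mul_nonneg (hq.1 x') (Real.rpow_nonneg (W.affinity_nonneg s x x') _)) (Finset.mem_univ x))
  simp [W.affinity_self hs]

theorem le_errorExponent {P : ℕ → ℝ} {c : ℝ}
    (h : ∀ᶠ n : ℕ in atTop, P n ≤ Real.exp (-(n * c))) : (c : EReal) ≤ errorExponent P := by
  refine le_liminf_of_le (by isBoundedDefault) ?_
  filter_upwards [h, eventually_ge_atTop 1] with n hn hn1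
  have hnpos : (0 : EReal) < (n : EReal) := by exact_mod_cast hn1
  rw [EReal.le_div_iff_mul_le hnpos (EReal.natCast_ne_top n)]
  have h1 : ENNReal.log (ENNReal.ofReal (P n)) ≤
      ENNReal.log (ENNReal.ofReal (Real.exp (-(n * c)))) :=
    ENNReal.log_monotone (ENNReal.ofReal_le_ofReal hn)
  rw [ENNReal.log_ofReal_of_pos (Real.exp_pos _), Real.log_exp] at h1
  refine le_trans (le_of_eq ?_) (EReal.neg_le_neg_iff.2 h1)
  rw [← EReal.coe_neg, neg_neg, mul_comm (n : ℝ), EReal.coe_mul]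
  rfl

/-- The 8 is the factor 4 from expurgation times the factor 2 from the type-class probability. -/
theorem tendsto_log_polynomial_div (d : ℕ) :
    Tendsto (fun n : ℕ => Real.log (8 * (n + 1 : ℝ) ^ d) / n) atTop (𝓝 0) := by
  have h1 : Tendsto (fun n : ℕ => (n + 1 : ℝ)) atTop atTop :=
    tendsto_atTop_add_const_right _ _ tendsto_natCast_atTop_atTop
  have h2 : Tendsto (fun n : ℕ => Real.log (n + 1 : ℝ) / (n : ℝ)) atTop (𝓝 0) := by
    have := (Real.tendsto_pow_log_div_mul_add_atTop 1 (-1) 1 one_ne_zero).comp h1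
    simpa [Function.comp_def] using this
  have h3 : Tendsto (fun n : ℕ => Real.log 8 / (n : ℝ)) atTop (𝓝 0) :=
    tendsto_const_div_atTop_nhds_zero_nat _
  have h4 := h3.add (h2.const_mul (d : ℝ))
  rw [mul_zero, add_zero] at h4
  refine h4.congr fun n => ?_
  have : (0 : ℝ) < n + 1 := by positivity
  rw [Real.log_mul (by norm_num) (by positivity), Real.log_pow]
  ring

theorem tendsto_div_of_sq_deviation_le {q : X → ℝ} {k : ℕ → X → ℕ}
    (h : ∀ n, ∑ a, ((k n a : ℝ) - n * q a) ^ 2 ≤ 2 * n + 1) :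
    Tendsto (fun (n : ℕ) (a : X) => (k n a : ℝ) / n) atTop (𝓝 q) := by
  rw [tendsto_pi_nhds]
  intro a
  have hsq : Tendsto (fun n : ℕ => ((k n a : ℝ) / n - q a) ^ 2) atTop (𝓝 0) := by
    refine squeeze_zero' (Eventually.of_forall fun n => sq_nonneg _) ?_
      (tendsto_const_div_atTop_nhds_zero_nat 3)
    filter_upwards [eventually_ge_atTop 1] with n hn
    have hn1 : (1 : ℝ) ≤ n := by exact_mod_cast hn
    have hn0 : (0 : ℝ) < n := by linarith
    have h1 := (Finset.single_le_sum (fun b _ => sq_nonneg ((k n b : ℝ) - n * q b))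
      (Finset.mem_univ a)).trans (h n)
    have h2 : ((k n a : ℝ) / n - q a) ^ 2 = ((k n a : ℝ) - n * q a) ^ 2 / n / n := by
      field_simp
    rw [h2, div_le_div_iff_of_pos_right hn0, div_le_iff₀ hn0]
    linarith
  have habs : Tendsto (fun n : ℕ => |(k n a : ℝ) / n - q a|) atTop (𝓝 0) := by
    have := (Real.continuous_sqrt.tendsto 0).comp hsq
    simpa [Function.comp_def, Real.sqrt_sq_eq_abs] using this
  have := tendsto_zero_iff_abs_tendsto_zero _ |>.2 habs
  exact tendsto_sub_nhds_zero_iff.1 this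

/-- The finite-length expurgated bound has exponent at least `E(ρ,s,q) - ρ R`. -/
theorem eventually_bound_le_exp {q : X → ℝ} {ρ s R c : ℝ} (hρ : 1 ≤ ρ) {M : ℕ → ℕ}
    (hM : ∀ n, 1 ≤ M n) (hR : Tendsto (fun n : ℕ => Real.log (M n : ℝ) / (n : ℝ)) atTop (𝓝 R))
    {k : ℕ → X → ℕ} (hk : Tendsto (fun (n : ℕ) (a : X) => (k n a : ℝ) / n) atTop (𝓝 q))
    (hc : c < expurgatedE W q ρ s - ρ * R) :
    ∀ᶠ n : ℕ in atTop, (4 * M n * ((1 / (2 * (n + 1 : ℝ) ^ Fintype.card X))⁻¹ *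
      Real.exp (∑ a, k n a * Real.log (W.meanAffinity q ρ s a)))) ^ ρ ≤ Real.exp (-(n * c)) := by
  have hlim : Tendsto (fun n : ℕ => -ρ * (Real.log (8 * (n + 1 : ℝ) ^ Fintype.card X) / n +
      Real.log (M n) / n + ∑ a, (k n a : ℝ) / n * Real.log (W.meanAffinity q ρ s a)))
      atTop (𝓝 (-ρ * (0 + R + ∑ a, q a * Real.log (W.meanAffinity q ρ s a)))) :=
    (((tendsto_log_polynomial_div _).add hR).add (tendsto_finsetSum _ fun a _ =>
      ((tendsto_pi_nhds.1 hk) a).mul_const _)).const_mul _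
  have hE : -ρ * (0 + R + ∑ a, q a * Real.log (W.meanAffinity q ρ s a)) =
      expurgatedE W q ρ s - ρ * R := by
    simp only [expurgatedE, DMC.meanAffinity, DMC.affinity]
    ring
  rw [hE] at hlim
  filter_upwards [hlim.eventually_const_lt hc, eventually_ge_atTop 1] with n hn hn1
  have hn0 : (0 : ℝ) < n := by exact_mod_cast hn1
  have hM0 : (0 : ℝ) < M n := by exact_mod_cast hM n
  have hpoly : (0 : ℝ) < 8 * (n + 1 : ℝ) ^ Fintype.card X := by positivity
  have hsum : ∑ a, (k n a : ℝ) / n * Real.log (W.meanAffinity q ρ s a) =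
      (∑ a, k n a * Real.log (W.meanAffinity q ρ s a)) / n := by
    rw [Finset.sum_div]
    exact Finset.sum_congr rfl fun a _ => by ring
  rw [hsum] at hn
  set S := ∑ a, k n a * Real.log (W.meanAffinity q ρ s a)
  have hbase : 4 * M n * ((1 / (2 * (n + 1 : ℝ) ^ Fintype.card X))⁻¹ * Real.exp S) =
      Real.exp (Real.log (8 * (n + 1 : ℝ) ^ Fintype.card X) + Real.log (M n) + S) := by
    rw [Real.exp_add, Real.exp_add, Real.exp_log hpoly, Real.exp_log hM0, one_div, inv_inv]
    ring
  rw [hbase, ← Real.exp_mul, Real.exp_le_exp]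
  have h2 := mul_le_mul_of_nonneg_left hn.le hn0.le
  have h3 : n * (-ρ * (Real.log (8 * (n + 1 : ℝ) ^ Fintype.card X) / n +
      Real.log (M n) / n + S / n)) =
      -((Real.log (8 * (n + 1 : ℝ) ^ Fintype.card X) + Real.log (M n) + S) * ρ) := by
    field_simp
  rw [h3] at h2
  linarith

/-- A code over the type class `k` on which the worst error probability obeys the expurgated
bound, simultaneously for all parameters of the bound. -/
theorem exists_code_pessimisticError_le [DecidableEq X] (W : DMC X Y) {q : X → ℝ} (hq : q ∈ stdSimplex ℝ X)
    {n : ℕ} {k : X → ℕ} {κ : ℝ} (hκ : 0 < κ)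
    (hk : κ ≤ ∑ x : Fin n → X with letterCount x = k, ∏ i, q (x i)) {M : ℕ} (hM : 1 ≤ M) :
    ∃ C : Code X n M, (∀ m, letterCount (C m) = k) ∧
      ∀ ρ s : ℝ, 1 ≤ ρ → s ∈ Set.Icc (0 : ℝ) 1 → ∀ m, pessimisticError W C m ≤
        (4 * M * (κ⁻¹ * Real.exp (∑ a, k a * Real.log (W.meanAffinity q ρ s a)))) ^ ρ := by
  classical
  let T := {x : Fin n → X // letterCount x = k}
  have hPpos : 0 < ∑ x : Fin n → X with letterCount x = k, ∏ i, q (x i) := hκ.trans_le hk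
  obtain ⟨x₀, hx₀, hx₀P⟩ := Finset.exists_ne_zero_of_sum_ne_zero hPpos.ne'
  have hx₀k : letterCount x₀ = k := (Finset.mem_filter.1 hx₀).2
  -- A class of positive `q`-probability uses only letters in the support of `q`; there the mean
  -- affinity is positive and `exp` undoes `log`.
  have hsupp : ∀ a, k a ≠ 0 → q a ≠ 0 := by
    intro a ha h0
    rw [← hx₀k] at ha
    obtain ⟨i, hi⟩ := Finset.card_ne_zero.1 ha
    refine hx₀P (Finset.prod_eq_zero (Finset.mem_univ i) ?_)
    rw [(Finset.mem_filter.1 hi).2, h0]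
  have : Nonempty T := ⟨⟨x₀, hx₀k⟩⟩
  have : Nonempty (Fin M) := ⟨⟨0, hM⟩⟩
  -- The code is fixed before `ρ` and `s` are introduced.
  obtain ⟨C, hC⟩ := Finite.exists_min
    (fun C : Fin M → T => ⨆ m, pessimisticError W (fun m => (C m).1) m)
  refine ⟨fun m => (C m).1, fun m => (C m).2, fun ρ s hρ hs m => ?_⟩
  have hρ0 : 0 < ρ := by linarith
  set b : X → X → ℝ := fun a a' => W.affinity s a a' ^ (1 / ρ) with hb
  have hb0 : ∀ a a', 0 ≤ b a a' := fun a a' => Real.rpow_nonneg (W.affinity_nonneg _ _ _) _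
  set A := κ⁻¹ * Real.exp (∑ a, k a * Real.log (W.meanAffinity q ρ s a)) with hA
  have hA0 : 0 ≤ A := by positivity
  have hrow : ∀ x : T, ∑ x' : T, ∏ i, b (x.1 i) (x'.1 i) ≤ A * Fintype.card T := by
    intro x
    have h := sum_letterCount_prod_le hq hκ hk hb0 x.1
    -- The product depends on the word only through its letter counts, so the bound is the same for
    -- every codeword.
    have hD : ∏ i, ∑ a', q a' * b (x.1 i) a' =
        Real.exp (∑ a, k a * Real.log (W.meanAffinity q ρ s a)) := by
      change ∏ i, W.meanAffinity q ρ s (x.1 i) = _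
      rw [prod_comp_eq_prod_letterCount x.1 (W.meanAffinity q ρ s), x.2, Real.exp_sum]
      refine Finset.prod_congr rfl fun a _ => ?_
      rcases eq_or_ne (k a) 0 with h0 | h0
      · simp [h0]
      · rw [Real.exp_nat_mul, Real.exp_log (DMC.meanAffinity_pos hq ρ hs (hsupp a h0))]
    rw [hD] at h
    rw [← Finset.sum_subtype (p := fun x' : Fin n → X => letterCount x' = k)
      (Finset.univ.filter fun x' : Fin n → X => letterCount x' = k) (by simp)
      (fun x' => ∏ i, b (x.1 i) (x' i)), Fintype.card_subtype]
    exact h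
  obtain ⟨C', hC'⟩ := exists_expurgated_code
    (f := fun x x' : T => ∏ i, b (x.1 i) (x'.1 i))
    (fun x x' => Finset.prod_nonneg fun i _ => hb0 _ _) hA0 hrow M
  have hbd : ∀ m, pessimisticError W (fun m => (C' m).1) m ≤ (4 * M * A) ^ ρ := by
    intro m
    have h := (pessimisticError_rpow_le (W := W) hs hρ (fun m => (C' m).1) m).trans (hC' m)
    have h2 := Real.rpow_le_rpow (Real.rpow_nonneg (pessimisticError_nonneg _ _) _) h hρ0.le
    rwa [← Real.rpow_mul (pessimisticError_nonneg _ _), one_div_mul_cancel hρ0.ne',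
      Real.rpow_one] at h2
  exact (le_ciSup (f := fun m => pessimisticError W (fun m => (C m).1) m)
    (Set.finite_range _).bddAbove m).trans ((hC C').trans (ciSup_le hbd))

end Exponent

end ChannelCoding

/-! ### The theorem. -/

theorem theorem1 {X Y : Type*} [Fintype X] [DecidableEq X] [Fintype Y]
    (W : ChannelCoding.DMC X Y) (q : X → ℝ) (hq : q ∈ stdSimplex ℝ X) (R : ℝ)
    (M : ℕ → ℕ) (hM : ∀ n, 1 ≤ M n)
    (hR : Tendsto (fun n : ℕ => Real.log (M n : ℝ) / (n : ℝ)) atTop (𝓝 R)) :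
    ∃ (t : ℕ → X → ℝ) (C : ∀ n : ℕ, ChannelCoding.Code X n (M n)),
      (∀ (n : ℕ) (m : Fin (M n)), ChannelCoding.empiricalDist (C n m) = t n) ∧
      Tendsto t atTop (𝓝 q) ∧
      ∀ g : ∀ n : ℕ, (Fin n → Y) → Fin (M n),
        (∀ n, ChannelCoding.IsMLDecoder W (C n) (g n)) →
        ChannelCoding.expurgatedExponent W R q ≤
          ChannelCoding.errorExponent
            (fun n => ChannelCoding.maxErrorProb W (C n) (g n)) := by
  choose k hk1 hk2 using fun n => ChannelCoding.exists_likely_letterCount hq n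
  have hk := ChannelCoding.tendsto_div_of_sq_deviation_le hk1
  choose C hCk hC using fun n =>
    ChannelCoding.exists_code_pessimisticError_le W hq (by positivity) (hk2 n) (hM n)
  refine ⟨fun n a => (k n a : ℝ) / n, C, fun n m => ?_, hk, fun g hg => ?_⟩
  · rw [ChannelCoding.empiricalDist_eq, hCk]
  · refine iSup₂_le fun ρ hρ => iSup₂_le fun s hs => EReal.ge_of_forall_gt_iff_ge.1 fun c hc => ?_
    refine ChannelCoding.le_errorExponent ?_
    filter_upwards [ChannelCoding.eventually_bound_le_exp hρ hM hR hk (EReal.coe_lt_coe_iff.1 hc)] with n hn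
    have : Nonempty (Fin (M n)) := ⟨⟨0, hM n⟩⟩
    exact ciSup_le fun m => ((ChannelCoding.condErrorProb_le_pessimisticError (hg n) m).trans
      (hC n ρ s hρ hs m)).trans hn
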